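/- **Conley-enriched stability.** Let $G$ be a finite simple graph (for instance a complete graph) on a totally ordered vertex set $V$, with edge set $E$, each edge being represented once as $(v_i,v_j)$ with $i<j$. Let $X=V\cup E$ carry the face order ($v\le e$ iff $v$ is an endpoint of $e$); for $A\subseteq X$ let $\operatorname{cl}A=\{x: x\le a \text{ for some } a\in A\}$ and $\operatorname{mo}A=\operatorname{cl}A\setminus A$. For a relation matrix $W\in\mathbb R^{V\times V}$ (not necessarily symmetric) and $\lambda\in\mathbb R$, let $\mathcal V_\lambda(W)$ be the partition of $X$ into the classes of the equivalence relation generated by $v_i\sim(v_i,v_j)$ whenever $W(i,j)>\lambda$ and $v_j\sim(v_i,v_j)$ whenever $W(j,i)>\lambda$, for edges $(v_i,v_j)\in E$. The $M$-graph of $\mathcal V_\lambda(W)$ has the blocks as nodes and an arrow $A\to B$ iff $B\cap(A\cup\operatorname{cl}A)\ne\emptyset$; the Morse sets at $\lambda$ are the unions $M\subseteq X$ of the blocks of its strongly connected components. Let the threshold $\lambda$ range over a compact interval $[a,c]$. A set $M$ that is a Morse set for some $\lambda\in[a,c]$ has birth $\lambda_b$ and death $\lambda_d$ equal to the supremum and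 the infimum of the $\lambda\in[a,c]$ at which it is a Morse set (so $\lambda_d=a$ if it survives down to $a$). Fix a field $F$ and let $\beta_k(M)=\dim_F H_k(\operatorname{cl}M,\operatorname{mo}M;F)$, the relative homology of the pair of subcomplexes of $G$. The Conley-enriched Morse persistence diagram $D_W^{(k)}$ is the multiset of labelled points $(\lambda_b,\lambda_d)$ with label $(k,\beta_k(M))$, one for each such $M$. For two labelled diagrams let $d_B$ be the infimum, over all partial matchings that only match points with equal labels, of the largest of the $\ell^\infty$-distances between matched points and of the $\ell^\infty$-distances of unmatched points to the diagonal $\{(t,t)\}$. Let $W,W'$ be relation matrices on $G$ with $\|W-W'\|_\infty=\max_{i,j}|W(i,j)-W'(i,j)|\le\varepsilon$. Then for every $k\ge 0$ $$d_B\bigl(D_W^{(k)},D_{W'}^{(k)}\bigr)\le\varepsilon ,$$ both when the diagrams of $W$ and $W'$ are taken over any common threshold range $[a,c]$, $a\le c$, and when each is taken over its own critical range, from the smallest to the largest of the values $W(i,j)$, respectively $W'(i,j)$, with $i,j$ adjacent in $G$. -/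

import Mathlib

open scoped ENNReal

noncomputable section

namespace ConleyMorse

/-! ### Multivector fields on posets, M-graphs and Morse sets -/

/-- Closure in the Alexandroff topology whose closed sets are the down-sets. -/
def cl {X : Type*} [PartialOrder X] (A : Set X) : Set X := {x | ∃ a ∈ A, x ≤ a}

/-- The mouth of `A`. -/
def mo {X : Type*} [PartialOrder X] (A : Set X) : Set X := cl A \ A

/-- A multivector field: a partition into non-empty locally closed (that is, convex) subsets. -/
structure MultivectorField (X : Type*) [PartialOrder X] where
  blocks : Set (Set X)
  isPartition : Setoid.IsPartition blocks
  locallyClosed : ∀ A ∈ blocks, A.OrdConnected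

/-- The image `Π(A) = A ∪ cl A` of a multivector `A`. -/
def image {X : Type*} [PartialOrder X] (A : Set X) : Set X := A ∪ cl A

/-- The arrows `A → B` of the M-graph, whose nodes are the multivectors. -/
def MArrow {X : Type*} [PartialOrder X] (P : MultivectorField X) (A B : Set X) : Prop :=
  A ∈ P.blocks ∧ B ∈ P.blocks ∧ (B ∩ image A).Nonempty

/-- The nodes of the strongly connected component of the multivector `A` in the M-graph. -/
def scc {X : Type*} [PartialOrder X] (P : MultivectorField X) (A : Set X) : Set (Set X) :=
  {B | B ∈ P.blocks ∧ Relation.ReflTransGen (MArrow P) A B ∧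
    Relation.ReflTransGen (MArrow P) B A}

/-- A Morse set: the union of the multivectors of a strongly connected component. -/
def IsMorseSet {X : Type*} [PartialOrder X] (P : MultivectorField X) (M : Set X) : Prop :=
  ∃ A ∈ P.blocks, M = ⋃₀ scc P A

/-! ### The poset of vertices and edges of a graph -/

/-- An edge, represented once, by its endpoints in increasing order. -/
structure Edge {V : Type*} [LinearOrder V] (G : SimpleGraph V) where
  fst : V
  snd : V
  lt : fst < snd
  adj : G.Adj fst snd

/-- The elements of `V ∪ E`. -/
inductive Cell {V : Type*} [LinearOrder V] (G : SimpleGraph V) where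
  | vertex (v : V) : Cell G
  | edge (e : Edge G) : Cell G

instance {V : Type*} [LinearOrder V] [Finite V] (G : SimpleGraph V) : Finite (Edge G) :=
  Finite.of_injective (fun e : Edge G => (e.fst, e.snd)) (by
    rintro ⟨a, b, _, _⟩ ⟨c, d, _, _⟩ h
    simp only [Prod.mk.injEq] at h
    obtain ⟨rfl, rfl⟩ := h
    rfl)

instance {V : Type*} [LinearOrder V] [Finite V] (G : SimpleGraph V) : Finite (Cell G) :=
  Finite.of_injective
    (fun c : Cell G => match c with
      | .vertex v => (Sum.inl v : V ⊕ Edge G)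
      | .edge e => Sum.inr e) (by
    rintro (a | a) (b | b) h <;> simp_all)

/-- The face order: `σ ≤ τ` iff they are equal or `σ` is an endpoint of the edge `τ`. -/
instance {V : Type*} [LinearOrder V] (G : SimpleGraph V) : PartialOrder (Cell G) where
  le σ τ := σ = τ ∨ ∃ e : Edge G, τ = .edge e ∧ (σ = .vertex e.fst ∨ σ = .vertex e.snd)
  le_refl σ := Or.inl rfl
  le_trans := by
    rintro a b c (rfl | ⟨e, rfl, h⟩) (rfl | ⟨f, rfl, h'⟩)
    · exact Or.inl rfl
    · exact Or.inr ⟨f, rfl, h'⟩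
    · exact Or.inr ⟨e, rfl, h⟩
    · simp at h'
  le_antisymm := by
    rintro a b (rfl | ⟨e, rfl, h⟩) (h' | ⟨f, rfl, h'⟩)
    · rfl
    · rfl
    · exact h'.symm
    · simp at h

/-! ### The graph multivector field of a relation matrix at a threshold -/

/-- The merges triggered by the relations that are active at threshold `t`. -/
inductive Trigger {V : Type*} [LinearOrder V] (G : SimpleGraph V) (W : V → V → ℝ) (t : ℝ) :
    Cell G → Cell G → Prop
  | fst (e : Edge G) (h : W e.fst e.snd > t) : Trigger G W t (.vertex e.fst) (.edge e)
  | snd (e : Edge G) (h : W e.snd e.fst > t) : Trigger G W t (.vertex e.snd) (.edge e)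

/-- Every set of vertices and edges is convex in the face order, which has height one. -/
theorem ordConnected_cell {V : Type*} [LinearOrder V] {G : SimpleGraph V} (A : Set (Cell G)) :
    A.OrdConnected := by
  refine ⟨fun x hx z hz y hy => ?_⟩
  obtain ⟨h1 | ⟨e, rfl, h⟩, h2 | ⟨f, rfl, h'⟩⟩ := hy
  · exact h1 ▸ hx
  · exact h1 ▸ hx
  · exact h2 ▸ hz
  · simp at h'

/-- The multivector field at threshold `t`: singletons are merged along active relations, and
transitively, so that the blocks are the classes of the generated equivalence relation. -/
def field {V : Type*} [LinearOrder V] (G : SimpleGraph V) (W : V → V → ℝ) (t : ℝ) :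
    MultivectorField (Cell G) where
  blocks := (Relation.EqvGen.setoid (Trigger G W t)).classes
  isPartition := Setoid.isPartition_classes _
  locallyClosed A _ := ordConnected_cell A

/-! ### The Conley index -/

/-- The dimension of a cell. -/
def Cell.dim {V : Type*} [LinearOrder V] {G : SimpleGraph V} : Cell G → ℕ
  | .vertex _ => 0
  | .edge _ => 1

/-- The boundary operator on chains with coefficients in `F`. -/
def boundary (F : Type*) [Field F] {V : Type*} [LinearOrder V] (G : SimpleGraph V) :
    (Cell G →₀ F) →ₗ[F] (Cell G →₀ F) :=
  Finsupp.linearCombination F fun c => match c with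
    | .vertex _ => 0
    | .edge e => Finsupp.single (.vertex e.snd) 1 - Finsupp.single (.vertex e.fst) 1

/-- The `k`-chains of `A`. -/
def chains (F : Type*) [Field F] {V : Type*} [LinearOrder V] {G : SimpleGraph V}
    (k : ℕ) (A : Set (Cell G)) : Submodule F (Cell G →₀ F) :=
  Finsupp.supported F F {c | c ∈ A ∧ c.dim = k}

/-- Relative `k`-cycles of a pair `(A, B)` of closed sets: `k`-chains of `A` with boundary in `B`. -/
def relCycles (F : Type*) [Field F] {V : Type*} [LinearOrder V] {G : SimpleGraph V}
    (k : ℕ) (A B : Set (Cell G)) : Submodule F (Cell G →₀ F) :=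
  chains F k A ⊓ (Finsupp.supported F F B).comap (boundary F G)

/-- Relative `k`-boundaries of a pair `(A, B)` of closed sets, together with the chains of `B`. -/
def relBoundaries (F : Type*) [Field F] {V : Type*} [LinearOrder V] {G : SimpleGraph V}
    (k : ℕ) (A B : Set (Cell G)) : Submodule F (Cell G →₀ F) :=
  (chains F (k + 1) A).map (boundary F G) ⊔ chains F k B

/-- The subquotient `Z / B` of a vector space, for subspaces `B ⊆ Z`. -/
abbrev Subquotient {F C : Type*} [Field F] [AddCommGroup C] [Module F C]
    (Z B : Submodule F C) : Type _ :=
  Z ⧸ B.submoduleOf Z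

/-- The relative homology `H_k(A, B; F)` of a pair `B ⊆ A` of closed sets, i.e. of subcomplexes
of the one-dimensional complex `G`. -/
abbrev RelHomology (F : Type*) [Field F] {V : Type*} [LinearOrder V] {G : SimpleGraph V}
    (k : ℕ) (A B : Set (Cell G)) : Type _ :=
  Subquotient (relCycles F k A B) (relBoundaries F k A B)

/-- The homological Conley index `CH_k(M) = H_k(cl M, mo M)`. -/
abbrev ConleyIndex (F : Type*) [Field F] {V : Type*} [LinearOrder V] {G : SimpleGraph V}
    (k : ℕ) (M : Set (Cell G)) : Type _ :=
  RelHomology F k (cl M) (mo M)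

/-- The Betti number `β_k` of the Conley index. -/
def betti (F : Type*) [Field F] {V : Type*} [LinearOrder V] {G : SimpleGraph V}
    (k : ℕ) (M : Set (Cell G)) : ℕ :=
  Module.finrank F (ConleyIndex F k M)

/-! ### The Conley-enriched Morse persistence diagram -/

/-- The thresholds in `[a, c]` at which `M` is a Morse set. -/
def aliveSet {V : Type*} [LinearOrder V] (G : SimpleGraph V) (W : V → V → ℝ) (a c : ℝ)
    (M : Set (Cell G)) : Set ℝ :=
  {t | t ∈ Set.Icc a c ∧ IsMorseSet (field G W t) M}

/-- The Morse sets that appear across the filtration over `[a, c]`. -/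
def morseSets {V : Type*} [LinearOrder V] (G : SimpleGraph V) (W : V → V → ℝ) (a c : ℝ) :
    Set (Set (Cell G)) :=
  {M | (aliveSet G W a c M).Nonempty}

/-- Thresholds are scanned downwards: `M` is born at the top of its set of thresholds. -/
def birth {V : Type*} [LinearOrder V] (G : SimpleGraph V) (W : V → V → ℝ) (a c : ℝ)
    (M : Set (Cell G)) : ℝ :=
  sSup (aliveSet G W a c M)

/-- `M` dies at the bottom of its set of thresholds; this is `a` if it survives down to `a`. -/
def death {V : Type*} [LinearOrder V] (G : SimpleGraph V) (W : V → V → ℝ) (a c : ℝ)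
    (M : Set (Cell G)) : ℝ :=
  sInf (aliveSet G W a c M)

/-- A point `(λ_b, λ_d)` with its label `(k, β_k)`. -/
abbrev LabelledPoint : Type := (ℝ × ℝ) × (ℕ × ℕ)

/-- The Conley-enriched Morse persistence diagram in degree `k`, over the threshold range
`[a, c]`: one labelled point for each Morse set that appears. -/
def diagram (F : Type*) [Field F] {V : Type*} [LinearOrder V] [Finite V] (G : SimpleGraph V)
    (W : V → V → ℝ) (a c : ℝ) (k : ℕ) : Multiset LabelledPoint :=
  (Set.toFinite (morseSets G W a c)).toFinset.val.map fun M =>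
    ((birth G W a c M, death G W a c M), (k, betti F k M))

/-- The critical thresholds. -/
def criticalValues {V : Type*} (G : SimpleGraph V) (W : V → V → ℝ) : Set ℝ :=
  {t | ∃ i j, G.Adj i j ∧ W i j = t}

/-- The diagram over the range `[min Λ, max Λ]` of the set `Λ` of critical thresholds. -/
def criticalDiagram (F : Type*) [Field F] {V : Type*} [LinearOrder V] [Finite V]
    (G : SimpleGraph V) (W : V → V → ℝ) (k : ℕ) : Multiset LabelledPoint :=
  diagram F G W (sInf (criticalValues G W)) (sSup (criticalValues G W)) k

/-! ### The bottleneck distance of labelled diagrams -/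

/-- Sup-norm distance of two points with the same label; `∞` if the labels differ. -/
def pointCost (p q : LabelledPoint) : ℝ≥0∞ := ⨅ _ : p.2 = q.2, edist p.1 q.1

/-- Sup-norm distance of a point to the diagonal. -/
def diagonalCost (p : LabelledPoint) : ℝ≥0∞ := ⨅ t : ℝ, edist p.1 (t, t)

/-- The bottleneck distance: the infimum over all matchings of the largest cost. A matching
consists of a multiset `m` of matched pairs, the remaining points `r₁` and `r₂` of the two
diagrams being matched to the diagonal. -/
def bottleneckDist (D₁ D₂ : Multiset LabelledPoint) : ℝ≥0∞ :=
  ⨅ (m : Multiset (LabelledPoint × LabelledPoint)) (r₁ : Multiset LabelledPoint)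
    (r₂ : Multiset LabelledPoint) (_ : D₁ = m.map Prod.fst + r₁) (_ : D₂ = m.map Prod.snd + r₂),
    (⨆ x ∈ m, pointCost x.1 x.2) ⊔ (⨆ p ∈ r₁, diagonalCost p) ⊔ (⨆ p ∈ r₂, diagonalCost p)

end ConleyMorse

end

/-!
A set is a Morse set exactly when it is strongly connected for the multivector dynamics and no
further cell is mutually reachable with it. Lowering the threshold coarsens the multivector field
and hence adds arrows: the first property persists downwards, the second upwards, and passing from
`W` to an `ε`-close `W'` costs a shift of the threshold by at most `ε`. So the thresholds at which
`M` is a Morse set form the intersection of a lower and an upper set, each of which moves by at most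
`ε`. If this interval is non-empty for both matrices, its endpoints move by at most `ε`; if it is
empty for one of them, it has length at most `2 ε` for the other, and half of this is the distance
to the diagonal. The Conley index depends only on `M`, so matching each Morse set with itself
respects the labels.
-/

namespace ConleyMorse

open Relation

section Dynamics

variable {X : Type*} [PartialOrder X] {P Q : MultivectorField X} {M : Set X}

/-- The multivector dynamics `x ↦ cl {x} ∪ [x]` as a relation on the points of the poset, which
replaces the M-graph: its strongly connected components are the Morse sets. -/
def Step (P : MultivectorField X) (x y : X) : Prop :=
  y ≤ x ∨ ∃ A ∈ P.blocks, x ∈ A ∧ y ∈ A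

/-- Reachability under the multivector dynamics. -/
def Reach (P : MultivectorField X) : X → X → Prop :=
  ReflTransGen (Step P)

theorem reach_of_reflTransGen_mArrow {A B : Set X} (hA : A ∈ P.blocks)
    (hAB : ReflTransGen (MArrow P) A B) {x y : X} (hx : x ∈ A) (hy : y ∈ B) : Reach P x y := by
  induction hAB generalizing y with
  | refl => exact .single (Or.inr ⟨A, hA, hx, hy⟩)
  | tail _ hBC ih =>
    obtain ⟨-, hC, z, hzC, hzB⟩ := hBC
    refine ReflTransGen.tail ?_ (Or.inr ⟨_, hC, hzC, hy⟩)
    rcases hzB with hzB | ⟨b, hb, hzb⟩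
    · exact ih hzB
    · exact (ih hb).tail (Or.inl hzb)

theorem Step.mArrow {A B : Set X} (hA : A ∈ P.blocks) (hB : B ∈ P.blocks) {x y : X}
    (hx : x ∈ A) (hy : y ∈ B) (hxy : Step P x y) : MArrow P A B := by
  refine ⟨hA, hB, y, hy, ?_⟩
  rcases hxy with hyx | ⟨C, hC, hxC, hyC⟩
  · exact Or.inr ⟨x, hx, hyx⟩
  · exact Or.inl ((P.isPartition.2 x).unique ⟨hC, hxC⟩ ⟨hA, hx⟩ ▸ hyC)

theorem Reach.reflTransGen_mArrow {A B : Set X} (hA : A ∈ P.blocks) (hB : B ∈ P.blocks)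
    {x y : X} (hx : x ∈ A) (hy : y ∈ B) (hxy : Reach P x y) :
    ReflTransGen (MArrow P) A B := by
  induction hxy generalizing B with
  | refl => exact (P.isPartition.2 x).unique ⟨hA, hx⟩ ⟨hB, hy⟩ ▸ .refl
  | @tail z _ _ hzy ih =>
    obtain ⟨C, ⟨hC, hzC⟩, -⟩ := P.isPartition.2 z
    exact (ih hC hzC).tail (hzy.mArrow hC hB hzC hy)

theorem sUnion_scc {A : Set X} (hA : A ∈ P.blocks) {x : X} (hx : x ∈ A) :
    ⋃₀ scc P A = {y | Reach P x y ∧ Reach P y x} := by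
  ext y
  constructor
  · rintro ⟨B, ⟨hB, hAB, hBA⟩, hy⟩
    exact ⟨reach_of_reflTransGen_mArrow hA hAB hx hy, reach_of_reflTransGen_mArrow hB hBA hy hx⟩
  · rintro ⟨hxy, hyx⟩
    obtain ⟨B, ⟨hB, hy⟩, -⟩ := P.isPartition.2 y
    exact ⟨B, ⟨hB, hxy.reflTransGen_mArrow hA hB hx hy, hyx.reflTransGen_mArrow hB hA hy hx⟩, hy⟩

/-- A non-empty set whose points reach one another; the connecting paths may leave the set. -/
def IsStronglyConnected (P : MultivectorField X) (M : Set X) : Prop :=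
  M.Nonempty ∧ ∀ x ∈ M, ∀ y ∈ M, Reach P x y

/-- A set that contains every point mutually reachable with one of its points, that is, a union of
strongly connected components. -/
def IsSaturated (P : MultivectorField X) (M : Set X) : Prop :=
  ∀ x ∈ M, ∀ y, Reach P x y → Reach P y x → y ∈ M

theorem isMorseSet_iff : IsMorseSet P M ↔ IsStronglyConnected P M ∧ IsSaturated P M := by
  constructor
  · rintro ⟨A, hA, rfl⟩
    obtain ⟨x, hx⟩ := Setoid.nonempty_of_mem_partition P.isPartition hA
    rw [sUnion_scc hA hx]
    exact ⟨⟨⟨x, .refl, .refl⟩, fun y hy z hz => hy.2.trans hz.1⟩,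
      fun y hy z hyz hzy => ⟨hy.1.trans hyz, hzy.trans hy.2⟩⟩
  · rintro ⟨⟨⟨x, hx⟩, hconn⟩, hsat⟩
    obtain ⟨A, ⟨hA, hxA⟩, -⟩ := P.isPartition.2 x
    refine ⟨A, hA, ?_⟩
    rw [sUnion_scc hA hxA]
    ext y
    exact ⟨fun hy => ⟨hconn x hx y hy, hconn y hy x hx⟩, fun hy => hsat x hx y hy.1 hy.2⟩

/-- Refinement of multivector fields: every multivector of `P` lies in one of `Q`. -/
def Refines (P Q : MultivectorField X) : Prop :=
  ∀ A ∈ P.blocks, ∃ B ∈ Q.blocks, A ⊆ B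

theorem Refines.reach (h : Refines P Q) {x y : X} (hxy : Reach P x y) : Reach Q x y := by
  refine ReflTransGen.mono (fun u v huv => huv.imp_right ?_) x y hxy
  rintro ⟨A, hA, hu, hv⟩
  obtain ⟨B, hB, hAB⟩ := h A hA
  exact ⟨B, hB, hAB hu, hAB hv⟩

theorem IsStronglyConnected.of_refines (h : Refines P Q) (hM : IsStronglyConnected P M) :
    IsStronglyConnected Q M :=
  ⟨hM.1, fun x hx y hy => h.reach (hM.2 x hx y hy)⟩

theorem IsSaturated.of_refines (h : Refines P Q) (hM : IsSaturated Q M) : IsSaturated P M :=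
  fun x hx y hxy hyx => hM x hx y (h.reach hxy) (h.reach hyx)

end Dynamics

section Intervals

theorem sSup_le_sSup_add {R : Type*} [ConditionallyCompleteLattice R] [Add R] [AddRightMono R]
    {A B : Set R} {ε : R} (hA : A.Nonempty) (hB : BddAbove B)
    (hAB : ∀ x ∈ A, ∃ y ∈ B, x ≤ y + ε) : sSup A ≤ sSup B + ε := by
  refine csSup_le hA fun x hx => ?_
  obtain ⟨y, hy, hxy⟩ := hAB x hx
  exact hxy.trans (add_le_add_left (le_csSup hB hy) ε)

theorem exists_mem_inter_abs_sub_le {R : Type*} [AddCommGroup R] [LinearOrder R]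
    [IsOrderedAddMonoid R] {L U : Set R} {ε t : R} (hε : 0 ≤ ε) (hL : IsLowerSet L)
    (hU : IsUpperSet U) (hLU : (L ∩ U).Nonempty) (htL : t - ε ∈ L) (htU : t + ε ∈ U) :
    ∃ s ∈ L ∩ U, |t - s| ≤ ε := by
  obtain ⟨r, hrL, hrU⟩ := hLU
  rcases le_total r (t - ε) with hr | hr
  · exact ⟨t - ε, ⟨htL, hU hr hrU⟩, by simp [abs_of_nonneg hε]⟩
  rcases le_total (t + ε) r with hr' | hr'
  · exact ⟨t + ε, ⟨hL hr' hrL, htU⟩, by simp [abs_of_nonneg hε]⟩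
  · exact ⟨r, ⟨hrL, hrU⟩, abs_sub_le_iff.2 ⟨sub_le_comm.1 hr, sub_le_iff_le_add'.2 hr'⟩⟩

variable {A B L U : Set ℝ} {ε : ℝ}

theorem abs_sSup_sub_sSup_le (hε : 0 ≤ ε) (hA : BddAbove A) (hB : BddAbove B)
    (hAB : ∀ x ∈ A, ∃ y ∈ B, |x - y| ≤ ε) (hBA : ∀ y ∈ B, ∃ x ∈ A, |y - x| ≤ ε) :
    |sSup A - sSup B| ≤ ε := by
  rcases A.eq_empty_or_nonempty with rfl | ⟨x, hx⟩
  · have hB_empty : B = ∅ := Set.eq_empty_of_forall_notMem fun y hy => by simpa using hBA y hy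
    simpa [hB_empty] using hε
  · obtain ⟨y, hy, -⟩ := hAB x hx
    have le_add_of_abs_sub_le {u v : ℝ} (huv : |u - v| ≤ ε) : u ≤ v + ε :=
      sub_le_iff_le_add'.1 (le_of_abs_le huv)
    refine abs_sub_le_iff.2 ⟨sub_le_iff_le_add'.2 ?_, sub_le_iff_le_add'.2 ?_⟩
    · exact sSup_le_sSup_add ⟨x, hx⟩ hB fun u hu =>
        (hAB u hu).imp fun _ h => h.imp_right le_add_of_abs_sub_le
    · exact sSup_le_sSup_add ⟨y, hy⟩ hA fun u hu =>
        (hBA u hu).imp fun _ h => h.imp_right le_add_of_abs_sub_le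

theorem abs_sInf_sub_sInf_le (hε : 0 ≤ ε) (hA : BddBelow A) (hB : BddBelow B)
    (hAB : ∀ x ∈ A, ∃ y ∈ B, |x - y| ≤ ε) (hBA : ∀ y ∈ B, ∃ x ∈ A, |y - x| ≤ ε) :
    |sInf A - sInf B| ≤ ε := by
  have neg_close : ∀ {C D : Set ℝ}, (∀ x ∈ C, ∃ y ∈ D, |x - y| ≤ ε) →
      ∀ x ∈ -C, ∃ y ∈ -D, |x - y| ≤ ε := by
    intro C D hCD x hx
    obtain ⟨y, hy, hxy⟩ := hCD (-x) hx
    exact ⟨-y, by simpa using hy, by rwa [sub_neg_eq_add, ← abs_neg, neg_add']⟩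
  rw [Real.sInf_def, Real.sInf_def, neg_sub_neg, abs_sub_comm]
  exact abs_sSup_sub_sSup_le hε hA.neg hB.neg (neg_close hAB) (neg_close hBA)

theorem sSup_sub_sInf_le_of_disjoint (hL : IsLowerSet L) (hLU : Disjoint L U) (hA : A.Nonempty)
    (hAL : ∀ t ∈ A, t - ε ∈ L) (hAU : ∀ t ∈ A, t + ε ∈ U) : sSup A - sInf A ≤ 2 * ε := by
  rw [sub_le_iff_le_add']
  refine csSup_le hA fun t ht => ?_
  rw [← sub_le_iff_le_add]
  refine le_csInf hA fun s hs => ?_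
  by_contra! hst
  exact Set.disjoint_left.1 hLU (hL (by linarith) (hAL t ht)) (hAU s hs)

end Intervals

section Thresholds

variable {V : Type*} [LinearOrder V] {G : SimpleGraph V} {W W' : V → V → ℝ}
  {a c a' c' ε s t : ℝ} {M : Set (Cell G)}

theorem refines_field (hW : ∀ i j, G.Adj i j → |W i j - W' i j| ≤ ε) (hst : s + ε ≤ t) :
    Refines (field G W t) (field G W' s) := by
  have active : ∀ i j, G.Adj i j → W i j > t → W' i j > s := fun i j hij h => by
    linarith [le_of_abs_le (hW i j hij)]
  rintro _ ⟨x, rfl⟩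
  refine ⟨_, ⟨x, rfl⟩, fun y hy => EqvGen.mono ?_ _ _ hy⟩
  rintro _ _ (⟨e, he⟩ | ⟨e, he⟩)
  · exact .fst e (active _ _ e.adj he)
  · exact .snd e (active _ _ e.adj.symm he)

/-- The thresholds up to `c` at which `M` is strongly connected. -/
def connectedBelow (G : SimpleGraph V) (W : V → V → ℝ) (c : ℝ) (M : Set (Cell G)) : Set ℝ :=
  {t | t ≤ c ∧ IsStronglyConnected (field G W t) M}

/-- The thresholds from `a` on at which `M` is saturated. -/
def saturatedAbove (G : SimpleGraph V) (W : V → V → ℝ) (a : ℝ) (M : Set (Cell G)) : Set ℝ :=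
  {t | a ≤ t ∧ IsSaturated (field G W t) M}

theorem aliveSet_eq_inter :
    aliveSet G W a c M = connectedBelow G W c M ∩ saturatedAbove G W a M := by
  ext t
  simp only [aliveSet, connectedBelow, saturatedAbove, isMorseSet_iff, Set.mem_Icc,
    Set.mem_inter_iff, Set.mem_ofPred_eq]
  tauto

theorem mem_connectedBelow_of_add_le (hW : ∀ i j, G.Adj i j → |W i j - W' i j| ≤ ε)
    (hc : c ≤ c' + ε) (hst : s + ε ≤ t) (ht : t ∈ connectedBelow G W c M) :
    s ∈ connectedBelow G W' c' M :=
  ⟨by linarith [ht.1], ht.2.of_refines (refines_field hW hst)⟩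

theorem mem_saturatedAbove_of_add_le (hW : ∀ i j, G.Adj i j → |W i j - W' i j| ≤ ε)
    (ha : a ≤ a' + ε) (hst : s + ε ≤ t) (hs : s ∈ saturatedAbove G W' a' M) :
    t ∈ saturatedAbove G W a M :=
  ⟨by linarith [hs.1], hs.2.of_refines (refines_field hW hst)⟩

theorem isLowerSet_connectedBelow : IsLowerSet (connectedBelow G W c M) :=
  fun _ _ hst => mem_connectedBelow_of_add_le (W := W) (ε := 0) (by simp) (by simp) (by simpa)

theorem isUpperSet_saturatedAbove : IsUpperSet (saturatedAbove G W a M) :=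
  fun _ _ hst => mem_saturatedAbove_of_add_le (W' := W) (ε := 0) (by simp) (by simp) (by simpa)

theorem sub_mem_connectedBelow (hW : ∀ i j, G.Adj i j → |W i j - W' i j| ≤ ε)
    (hc : |c - c'| ≤ ε) (ht : t ∈ aliveSet G W a c M) : t - ε ∈ connectedBelow G W' c' M := by
  rw [aliveSet_eq_inter] at ht
  exact mem_connectedBelow_of_add_le hW (by linarith [le_of_abs_le hc]) (by simp) ht.1

theorem add_mem_saturatedAbove (hW : ∀ i j, G.Adj i j → |W i j - W' i j| ≤ ε)
    (ha : |a - a'| ≤ ε) (ht : t ∈ aliveSet G W a c M) : t + ε ∈ saturatedAbove G W' a' M := by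
  rw [aliveSet_eq_inter] at ht
  exact mem_saturatedAbove_of_add_le (fun i j hij => abs_sub_comm (W i j) _ ▸ hW i j hij)
    (by linarith [neg_le_of_abs_le ha]) le_rfl ht.2

theorem exists_mem_aliveSet_abs_sub_le (hW : ∀ i j, G.Adj i j → |W i j - W' i j| ≤ ε)
    (ha : |a - a'| ≤ ε) (hc : |c - c'| ≤ ε) (hM : (aliveSet G W' a' c' M).Nonempty) :
    ∀ t ∈ aliveSet G W a c M, ∃ s ∈ aliveSet G W' a' c' M, |t - s| ≤ ε := by
  intro t ht
  rw [aliveSet_eq_inter] at hM ⊢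
  exact exists_mem_inter_abs_sub_le ((abs_nonneg _).trans ha) isLowerSet_connectedBelow
    isUpperSet_saturatedAbove hM (sub_mem_connectedBelow hW hc ht)
    (add_mem_saturatedAbove hW ha ht)

theorem bddAbove_aliveSet : BddAbove (aliveSet G W a c M) :=
  bddAbove_Icc.mono fun _ ht => ht.1

theorem bddBelow_aliveSet : BddBelow (aliveSet G W a c M) :=
  bddBelow_Icc.mono fun _ ht => ht.1

theorem dist_birth_death_le (hW : ∀ i j, G.Adj i j → |W i j - W' i j| ≤ ε)
    (ha : |a - a'| ≤ ε) (hc : |c - c'| ≤ ε) (hM : M ∈ morseSets G W a c)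
    (hM' : M ∈ morseSets G W' a' c') :
    dist (birth G W a c M, death G W a c M) (birth G W' a' c' M, death G W' a' c' M) ≤ ε := by
  have hε : 0 ≤ ε := (abs_nonneg _).trans ha
  have close := exists_mem_aliveSet_abs_sub_le hW ha hc hM'
  have close' := exists_mem_aliveSet_abs_sub_le
    (fun i j hij => abs_sub_comm (W i j) _ ▸ hW i j hij)
    (abs_sub_comm a a' ▸ ha) (abs_sub_comm c c' ▸ hc) hM
  exact max_le (abs_sSup_sub_sSup_le hε bddAbove_aliveSet bddAbove_aliveSet close close')
    (abs_sInf_sub_sInf_le hε bddBelow_aliveSet bddBelow_aliveSet close close')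

theorem abs_birth_sub_death_le (hW : ∀ i j, G.Adj i j → |W i j - W' i j| ≤ ε)
    (ha : |a - a'| ≤ ε) (hc : |c - c'| ≤ ε) (hM : M ∈ morseSets G W a c)
    (hM' : M ∉ morseSets G W' a' c') : |birth G W a c M - death G W a c M| ≤ 2 * ε := by
  have disjoint : Disjoint (connectedBelow G W' c' M) (saturatedAbove G W' a' M) := by
    rwa [Set.disjoint_iff_inter_eq_empty, ← aliveSet_eq_inter, ← Set.not_nonempty_iff_eq_empty]
  have death_le_birth : death G W a c M ≤ birth G W a c M :=
    csInf_le_csSup hM bddBelow_aliveSet bddAbove_aliveSet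
  rw [abs_of_nonneg (sub_nonneg.2 death_le_birth)]
  exact sSup_sub_sInf_le_of_disjoint isLowerSet_connectedBelow disjoint hM
    (fun _ => sub_mem_connectedBelow hW hc) (fun _ => add_mem_saturatedAbove hW ha)

end Thresholds

section Bottleneck

variable {D₁ D₂ r₁ r₂ : Multiset LabelledPoint} {p q : LabelledPoint} {ε : ℝ} {r : ℝ≥0∞}

theorem pointCost_le (hlabel : p.2 = q.2) (hdist : dist p.1 q.1 ≤ ε) :
    pointCost p q ≤ ENNReal.ofReal ε := by
  refine iInf_le_of_le hlabel ?_
  rw [edist_dist]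
  exact ENNReal.ofReal_le_ofReal hdist

theorem diagonalCost_le (h : |p.1.1 - p.1.2| ≤ 2 * ε) : diagonalCost p ≤ ENNReal.ofReal ε := by
  refine iInf_le_of_le (midpoint ℝ p.1.1 p.1.2) ?_
  rw [edist_dist]
  refine ENNReal.ofReal_le_ofReal (max_le ?_ ?_)
  · rw [dist_left_midpoint, Real.norm_two, Real.dist_eq]
    linarith
  · rw [dist_right_midpoint, Real.norm_two, Real.dist_eq]
    linarith

theorem bottleneckDist_le (m : Multiset (LabelledPoint × LabelledPoint))
    (hD₁ : D₁ = m.map Prod.fst + r₁) (hD₂ : D₂ = m.map Prod.snd + r₂)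
    (hm : ∀ x ∈ m, pointCost x.1 x.2 ≤ r) (hr₁ : ∀ p ∈ r₁, diagonalCost p ≤ r)
    (hr₂ : ∀ p ∈ r₂, diagonalCost p ≤ r) : bottleneckDist D₁ D₂ ≤ r :=
  iInf_le_of_le m <| iInf_le_of_le r₁ <| iInf_le_of_le r₂ <| iInf_le_of_le hD₁ <|
    iInf_le_of_le hD₂ <| sup_le (sup_le (iSup₂_le hm) (iSup₂_le hr₁)) (iSup₂_le hr₂)

theorem bottleneckDist_map_le {ι : Type*} (S T : Finset ι) (f g : ι → LabelledPoint)
    (hfg : ∀ i ∈ S, i ∈ T → pointCost (f i) (g i) ≤ r)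
    (hf : ∀ i ∈ S, i ∉ T → diagonalCost (f i) ≤ r)
    (hg : ∀ i ∈ T, i ∉ S → diagonalCost (g i) ≤ r) :
    bottleneckDist (S.val.map f) (T.val.map g) ≤ r := by
  classical
  have inter_add_sdiff (A B : Finset ι) : A.val = (A ∩ B).val + (A \ B).val := by
    rw [Finset.inter_val, Finset.sdiff_val, add_comm, Multiset.sub_add_inter]
  refine bottleneckDist_le ((S ∩ T).val.map fun i => (f i, g i)) (r₁ := (S \ T).val.map f)
    (r₂ := (T \ S).val.map g) ?_ ?_ ?_ ?_ ?_
  · rw [Multiset.map_map, inter_add_sdiff S T, Multiset.map_add]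
    rfl
  · rw [Multiset.map_map, inter_add_sdiff T S, Multiset.map_add, Finset.inter_comm]
    rfl
  · exact Multiset.forall_mem_map_iff.2 fun i hi =>
      hfg i (Finset.mem_inter.1 hi).1 (Finset.mem_inter.1 hi).2
  · exact Multiset.forall_mem_map_iff.2 fun i hi =>
      hf i (Finset.mem_sdiff.1 hi).1 (Finset.mem_sdiff.1 hi).2
  · exact Multiset.forall_mem_map_iff.2 fun i hi =>
      hg i (Finset.mem_sdiff.1 hi).1 (Finset.mem_sdiff.1 hi).2

end Bottleneck

theorem bottleneckDist_diagram_le {F : Type*} [Field F] {V : Type*} [LinearOrder V] [Finite V]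
    {G : SimpleGraph V} {W W' : V → V → ℝ} {a c a' c' ε : ℝ}
    (hW : ∀ i j, G.Adj i j → |W i j - W' i j| ≤ ε) (ha : |a - a'| ≤ ε) (hc : |c - c'| ≤ ε)
    (k : ℕ) :
    bottleneckDist (diagram F G W a c k) (diagram F G W' a' c' k) ≤ ENNReal.ofReal ε := by
  refine bottleneckDist_map_le _ _ _ _ (fun M hM hM' => ?_) (fun M hM hM' => ?_)
    (fun M hM' hM => ?_) <;> rw [Set.Finite.mem_toFinset] at hM hM'
  · exact pointCost_le rfl (dist_birth_death_le hW ha hc hM hM')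
  · exact diagonalCost_le (abs_birth_sub_death_le hW ha hc hM hM')
  · exact diagonalCost_le (abs_birth_sub_death_le
      (fun i j hij => abs_sub_comm (W i j) _ ▸ hW i j hij)
      (abs_sub_comm a a' ▸ ha) (abs_sub_comm c c' ▸ hc) hM' hM)

section CriticalValues

variable {V : Type*} {G : SimpleGraph V} {W W' : V → V → ℝ} {ε : ℝ}

theorem finite_criticalValues [Finite V] (G : SimpleGraph V) (W : V → V → ℝ) :
    (criticalValues G W).Finite :=
  (Set.finite_range (Function.uncurry W)).subset fun _ ⟨i, j, _, hij⟩ => ⟨(i, j), hij⟩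

theorem exists_mem_criticalValues_abs_sub_le (hW : ∀ i j, G.Adj i j → |W i j - W' i j| ≤ ε) :
    ∀ t ∈ criticalValues G W, ∃ s ∈ criticalValues G W', |t - s| ≤ ε := by
  rintro _ ⟨i, j, hij, rfl⟩
  exact ⟨W' i j, ⟨i, j, hij, rfl⟩, hW i j hij⟩

end CriticalValues

end ConleyMorse

theorem mainTheorem2_general {F : Type*} [Field F] {V : Type*} [Finite V] [LinearOrder V]
    {G : SimpleGraph V} {W W' : V → V → ℝ} {ε : ℝ} (hε : 0 ≤ ε)
    (hW : ∀ i j, G.Adj i j → |W i j - W' i j| ≤ ε) (k : ℕ) :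
    (∀ a c a' c' : ℝ, |a - a'| ≤ ε → |c - c'| ≤ ε →
      ConleyMorse.bottleneckDist (ConleyMorse.diagram F G W a c k)
        (ConleyMorse.diagram F G W' a' c' k) ≤ ENNReal.ofReal ε) ∧
    ConleyMorse.bottleneckDist (ConleyMorse.criticalDiagram F G W k)
      (ConleyMorse.criticalDiagram F G W' k) ≤ ENNReal.ofReal ε := by
  have close := ConleyMorse.exists_mem_criticalValues_abs_sub_le hW
  have close' := ConleyMorse.exists_mem_criticalValues_abs_sub_le
    fun i j hij => abs_sub_comm (W i j) _ ▸ hW i j hij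
  have finite := ConleyMorse.finite_criticalValues G
  exact ⟨fun a c a' c' ha hc => ConleyMorse.bottleneckDist_diagram_le hW ha hc k,
    ConleyMorse.bottleneckDist_diagram_le hW
      (ConleyMorse.abs_sInf_sub_sInf_le hε (finite W).bddBelow (finite W').bddBelow close close')
      (ConleyMorse.abs_sSup_sub_sSup_le hε (finite W).bddAbove (finite W').bddAbove close close')
      k⟩

/-- `‖W - W'‖` is the sup norm on the entries. The threshold range of the filtration is either any
fixed compact interval, or the range of the critical thresholds of the respective matrix. -/
theorem mainTheorem2 {F : Type*} [Field F] {V : Type*} [Fintype V] [LinearOrder V]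
    (G : SimpleGraph V) (W W' : V → V → ℝ) (ε : ℝ) (hW : ‖W - W'‖ ≤ ε) (k : ℕ) :
    (∀ a c : ℝ, a ≤ c →
      ConleyMorse.bottleneckDist (ConleyMorse.diagram F G W a c k)
        (ConleyMorse.diagram F G W' a c k) ≤ ENNReal.ofReal ε) ∧
    ConleyMorse.bottleneckDist (ConleyMorse.criticalDiagram F G W k)
      (ConleyMorse.criticalDiagram F G W' k) ≤ ENNReal.ofReal ε := by
  have hε : 0 ≤ ε := (norm_nonneg _).trans hW
  have hentry (i j : V) : |W i j - W' i j| ≤ ε :=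
    ((norm_le_pi_norm ((W - W') i) j).trans (norm_le_pi_norm (W - W') i)).trans hW
  have general := mainTheorem2_general (F := F) (G := G) hε (fun i j _ => hentry i j) k
  exact ⟨fun a c _ => general.1 a c a c (by simpa) (by simpa), general.2⟩
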